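/- **Setting.** For $N\ge 1$ let $\Lambda_N=\{k\in\mathbb Z^3\setminus\{0\}:|k|_\infty\le N\}$, let $O_h$ be the group of the 48 signed permutations of the coordinates, and let $\mathcal O_N=\Lambda_N/O_h$, with orbits $\Omega_\alpha$. Write $|k|$ for the Euclidean length and $P(k)=I-\frac{k\otimes k}{|k|^2}$ for $k\ne 0$. For coefficients $(\hat u_k)_{k\in\Lambda_N}$ in $\mathbb C^3$ define the real matrix $S=(S_{\alpha\beta})_{\alpha,\beta\in\mathcal O_N}$ by $$S_{\alpha\beta}=\frac1{|\Omega_\alpha|}\sum_{k\in\Omega_\alpha}\ \sum_{\substack{p\in\Omega_\beta\\ q=k-p\in\Lambda_N}}|k|^2\,\mathrm{Re}\Bigl(\overline{\hat u_k}\cdot(-i)P(k)\bigl[q\,(\hat u_p\cdot\hat u_q)\bigr]\Bigr),$$ where $x\cdot y=\sum_j x_jy_j$ is bilinear. Put $V_N=\tfrac12(S+S^T)$, let $\rho(V_N)$ be its spectral radius, and let $\nu_c^*(N)=\rho(V_N)/N^2$. **Ensemble.** Choose a half-lattice containing exactly one of $k,-k$ for every $k\in\Lambda_N$ (those $k$ whose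 first nonzero coordinate is positive). Let $g_k\in\mathbb C^3$, for $k$ in the half-lattice, have independent standard complex Gaussian components. Fix $a\in\{0,1\}$, and set $v_k=|k|^{-a}P(k)g_k$ and $v_{-k}=\overline{v_k}$. Finally let $\hat u_k=v_k/\sqrt W$ with $W=\frac12\sum_{k\in\Lambda_N}|k|^2|v_k|^2$, so that almost surely $\frac12\sum_{k\in\Lambda_N}|k|^2|\hat u_k|^2=1$. ($a=0$: unweighted Gaussian coordinates; $a=1$: $\mathbb E|v_k|^2$ proportional to $|k|^{-2}$.) **Theorem (Improved ensemble stretching bound).** For every $\varepsilon>0$ there is a constant $C_\varepsilon>0$ such that, for both $a\in\{0,1\}$ and every $N\ge 1$, the random variables $\rho(V_N)$ and $\nu_c^*(N)$ are integrable and $$\mathbb E\,\rho(V_N)\le C_\varepsilon N^{-3/2+\varepsilon},\qquad \mathbb E\,\nu_c^*(N)\le C_\varepsilon N^{-7/2+\varepsilon}.$$ -/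

import Mathlib

open MeasureTheory ProbabilityTheory
open scoped Matrix

noncomputable section

namespace OrbitStretching

/-! ## The truncated lattice and its octahedral orbits -/

/-- The truncated nonzero Fourier lattice `Λ_N = {k ∈ ℤ³ \ {0} : |k|_∞ ≤ N}`. -/
def lattice (N : ℕ) : Finset (Fin 3 → ℤ) :=
  (Fintype.piFinset fun _ => Finset.Icc (-(N : ℤ)) (N : ℤ)).erase 0

/-- The squared Euclidean length `|k|² = k₁² + k₂² + k₃²`. -/
def sqLength (k : Fin 3 → ℤ) : ℝ := ∑ i, (k i : ℝ) ^ 2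

/-- The wave vector `k` as a vector of `ℂ³`. -/
def waveVec (k : Fin 3 → ℤ) : Fin 3 → ℂ := fun i => (k i : ℂ)

/-- The relation on `Λ_N` of lying in the same orbit of the full octahedral group `O_h`, the group of
the 48 signed permutations `k ↦ (ε₁ k_{σ 1}, ε₂ k_{σ 2}, ε₃ k_{σ 3})` of the coordinates. -/
def octahedralSetoid (N : ℕ) : Setoid (lattice N) where
  r k l := ∃ (σ : Equiv.Perm (Fin 3)) (s : Fin 3 → ℤˣ), ∀ i, l.1 i = (s i : ℤ) * k.1 (σ i)
  iseqv :=
    { refl := fun k => ⟨1, 1, fun i => by simp⟩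
      symm := by
        rintro k l ⟨σ, s, h⟩
        refine ⟨σ⁻¹, fun i => s (σ⁻¹ i), fun i => ?_⟩
        rw [h, ← mul_assoc, ← Units.val_mul, Int.units_mul_self]
        simp
      trans := by
        rintro k l m ⟨σ, s, h⟩ ⟨τ, t, h'⟩
        refine ⟨σ * τ, fun i => t i * s (τ i), fun i => ?_⟩
        rw [h', h, Units.val_mul, mul_assoc, Equiv.Perm.mul_apply] }

/-- The orbit set `𝒪_N = Λ_N / O_h`. -/
def Orbit (N : ℕ) : Type := Quotient (octahedralSetoid N)

/-- The orbit of a mode `k ∈ Λ_N`. -/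
def orbitOf (N : ℕ) (k : lattice N) : Orbit N := Quotient.mk (octahedralSetoid N) k

instance instDecidableEqOrbit (N : ℕ) : DecidableEq (Orbit N) := Classical.decEq _

instance instFintypeOrbit (N : ℕ) : Fintype (Orbit N) :=
  Fintype.ofSurjective (orbitOf N) Quotient.mk_surjective

/-- The set `Ω_α ⊆ Λ_N` of the modes in the orbit `α`. -/
def orbitModes (N : ℕ) (α : Orbit N) : Finset (lattice N) :=
  Finset.univ.filter fun k => orbitOf N k = α

/-! ## The orbit transfer matrix of a field of Fourier coefficients -/

/-- The Leray projector `P(k) = I - k ⊗ k / |k|²`. -/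
def leray (k : Fin 3 → ℤ) : Matrix (Fin 3) (Fin 3) ℂ :=
  1 - ((sqLength k : ℂ)⁻¹) • Matrix.vecMulVec (waveVec k) (waveVec k)

/-- `N_{k,p} = -i P(k)[q (û_p · û_q)]` with `q = k - p`; the dot product is bilinear. -/
def interaction (u : (Fin 3 → ℤ) → Fin 3 → ℂ) (k p : Fin 3 → ℤ) : Fin 3 → ℂ :=
  -Complex.I • (leray k *ᵥ ((u p ⬝ᵥ u (k - p)) • waveVec (k - p)))

/-- The contribution `|k|² Re(conj(û_k) · N_{k,p})` of the triad `(k, p, k - p)`. -/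
def triadTerm (u : (Fin 3 → ℤ) → Fin 3 → ℂ) (k p : Fin 3 → ℤ) : ℝ :=
  sqLength k * (star (u k) ⬝ᵥ interaction u k p).re

/-- The raw orbit-pair transfer
`S_{αβ} = |Ω_α|⁻¹ ∑_{k ∈ Ω_α} ∑_{p ∈ Ω_β, k - p ∈ Λ_N} |k|² Re(conj(û_k) · N_{k,p})`. -/
def transferMatrix (N : ℕ) (u : (Fin 3 → ℤ) → Fin 3 → ℂ) : Matrix (Orbit N) (Orbit N) ℝ :=
  Matrix.of fun α β =>
    ((orbitModes N α).card : ℝ)⁻¹ *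
      ∑ k ∈ orbitModes N α,
        ∑ p ∈ (orbitModes N β).filter (fun p => k.1 - p.1 ∈ lattice N), triadTerm u k.1 p.1

/-- The orbit-level stretching matrix, the symmetric part `V_{αβ} = (S_{αβ} + S_{βα}) / 2`. -/
def stretchingMatrix (N : ℕ) (u : (Fin 3 → ℤ) → Fin 3 → ℂ) : Matrix (Orbit N) (Orbit N) ℝ :=
  (1 / 2 : ℝ) • (transferMatrix N u + (transferMatrix N u)ᵀ)

/-- The spectral radius of a real square matrix: the largest modulus of its complex eigenvalues. -/
def specRadius {ι : Type} [Fintype ι] [DecidableEq ι] (M : Matrix ι ι ℝ) : ℝ :=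
  (spectralRadius ℂ (M.map Complex.ofReal)).toReal

/-! ## The isotropic unit-energy ensemble -/

/-- The half-lattice: the modes of `Λ_N` whose first nonzero coordinate is positive. It contains
exactly one of `k` and `-k` for every `k ∈ Λ_N`. -/
def halfLattice (N : ℕ) : Finset (Fin 3 → ℤ) :=
  (lattice N).filter fun k =>
    0 < k 0 ∨ (k 0 = 0 ∧ 0 < k 1) ∨ (k 0 = 0 ∧ k 1 = 0 ∧ 0 < k 2)

/-- The coordinates of a sample: real (`0`) and imaginary (`1`) parts of three complex numbers for
every mode of the half-lattice. -/
abbrev Sample (N : ℕ) : Type := halfLattice N × Fin 3 × Fin 2 → ℝ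

/-- The law of the coordinates: all complex coordinates are independent and standard complex Gaussian,
that is, their real and imaginary parts are independent centred Gaussians of variance `1/2`. -/
def gaussianLaw (N : ℕ) : Measure (Sample N) :=
  Measure.pi fun _ => gaussianReal 0 (1 / 2)

/-- The Gaussian vector in `ℂ³` attached to a mode of the half-lattice (and `0` at other modes). -/
def gaussianVec (N : ℕ) (ω : Sample N) (k : Fin 3 → ℤ) : Fin 3 → ℂ := fun j =>
  if h : k ∈ halfLattice N then (ω (⟨k, h⟩, j, 0) : ℂ) + (ω (⟨k, h⟩, j, 1) : ℂ) * Complex.I else 0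

/-- The weighted projection `|k|^{-a} P(k) g_k` of the Gaussian vector onto the plane `k^⊥`. -/
def projectedVec (N a : ℕ) (ω : Sample N) (k : Fin 3 → ℤ) : Fin 3 → ℂ :=
  ((Real.sqrt (sqLength k) ^ a : ℝ) : ℂ)⁻¹ • (leray k *ᵥ gaussianVec N ω k)

/-- The unnormalized coefficients `v_k`: the projected vector on the half-lattice, extended by the
reality constraint `v_{-k} = conj(v_k)`. They vanish outside `Λ_N`. -/
def rawField (N a : ℕ) (ω : Sample N) (k : Fin 3 → ℤ) : Fin 3 → ℂ :=
  if k ∈ halfLattice N then projectedVec N a ω k else star (projectedVec N a ω (-k))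

/-- The energy `(1/2) ∑_{k ∈ Λ_N} |k|² |v_k|²` used for the normalization. -/
def energy (N : ℕ) (v : (Fin 3 → ℤ) → Fin 3 → ℂ) : ℝ :=
  (1 / 2) * ∑ k ∈ lattice N, sqLength k * ∑ j, ‖v k j‖ ^ 2

/-- The random field `û_k = v_k / √W`, where `W` is the energy of `v`; its energy is almost surely
equal to `1`. -/
def ensembleField (N a : ℕ) (ω : Sample N) (k : Fin 3 → ℤ) : Fin 3 → ℂ :=
  ((Real.sqrt (energy N (rawField N a ω)) : ℂ)⁻¹) • rawField N a ω k

/-- The spectral radius `ρ(V_N)` of the stretching matrix of the random field. -/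
def rho (N a : ℕ) (ω : Sample N) : ℝ :=
  specRadius (stretchingMatrix N (ensembleField N a ω))

/-- The critical threshold `ν_c^*(N) = ρ(V_N) / N²`. -/
def nuCrit (N a : ℕ) (ω : Sample N) : ℝ := rho N a ω / (N : ℝ) ^ 2

end OrbitStretching

end

/-!
The spectral radius of the stretching matrix is controlled by its Frobenius norm, and the Frobenius
norm already has the claimed size; even the rate without `ε` holds.

Deterministic part. Put `w k = |k|² |û_k|²`, so that the weights `w k` sum to at most `2`. Since
`|k|² |P(k) q|² = |k × q|² = |p × q|² ≤ |p|² |q|²` for `q = k - p`, every triad satisfies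
`(triadTerm u k p)² ≤ w k * w p * w q` (`triadTerm_sq_le`). Orbits have at most `48` elements, so
the squared Frobenius norm is at most `48 ∑ w k * w p * w (k - p)`, and Young's inequality for the
convolution bounds this by `48 (∑ w) (∑ w²)` (`specRadius_stretchingMatrix_sq_le`). In particular
`ρ² ≤ 384` always (`rho_sq_le_const`).

Probabilistic part. Write `w = x / W` with `x k = |k|² |v_k|²`. With `D = N ^ (2 - 2 * a)`, the sum
`∑ x²` has expectation of order at most `N³ D²`. The energy `W` is at least half of
`Z = halfEnergy`, a sum of independent terms over the half-lattice, whose mean `m` is at least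
of order `N³ D` (`le_meanHalfEnergy`) and whose variance is at most of order `N³ D²`
(`integral_halfEnergy_sub_sq_le`). Where `Z ≥ m / 2` the weights satisfy `∑ w² ≤ 16 ∑ x² / m²`;
elsewhere the deterministic bound is dominated by a multiple of `(Z - m)² / m²`. Hence
`ρ² ≤ C (∑ x² + (Z - m)²) / m²` pointwise (`rho_sq_le_add`), so `𝔼 ρ² ≤ C N⁻³`
(`integral_rho_sq_le`), and `𝔼 ρ ≤ C N ^ (-3/2)` follows by the arithmetic-geometric mean
inequality. Measurability of `ρ` comes from Gelfand's formula (`measurable_specRadius`).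
-/

noncomputable section

namespace OrbitStretching

/-! ### The spectral radius and the Frobenius norm -/

/-- Every eigenvalue of a complex matrix is bounded by its Frobenius norm. -/
lemma norm_sq_le_of_mem_spectrum {ι : Type} [Fintype ι] [DecidableEq ι] (A : Matrix ι ι ℂ) {z : ℂ}
    (hz : z ∈ spectrum ℂ A) : ‖z‖ ^ 2 ≤ ∑ i, ∑ j, ‖A i j‖ ^ 2 := by
  rw [← Matrix.spectrum_toLin', ← Module.End.hasEigenvalue_iff_mem_spectrum] at hz
  obtain ⟨v, hv⟩ := hz.exists_hasEigenvector
  have hv' : A *ᵥ v = z • v := by simpa using hv.apply_eq_smul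
  have hpos : 0 < ∑ j, ‖v j‖ ^ 2 := by
    obtain ⟨j, hj⟩ := Function.ne_iff.mp hv.2
    refine Finset.sum_pos' (fun _ _ => by positivity) ⟨j, Finset.mem_univ _, ?_⟩
    have : 0 < ‖v j‖ := norm_pos_iff.mpr hj
    positivity
  refine le_of_mul_le_mul_right ?_ hpos
  calc ‖z‖ ^ 2 * ∑ j, ‖v j‖ ^ 2 = ∑ i, ‖(A *ᵥ v) i‖ ^ 2 := by
        rw [hv', Finset.mul_sum]
        exact Finset.sum_congr rfl fun i _ => by simp [mul_pow]
    _ ≤ ∑ i, (∑ j, ‖A i j‖ ^ 2) * ∑ j, ‖v j‖ ^ 2 := by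
        refine Finset.sum_le_sum fun i _ => ?_
        calc ‖(A *ᵥ v) i‖ ^ 2 ≤ (∑ j, ‖A i j‖ * ‖v j‖) ^ 2 := by
              refine pow_le_pow_left₀ (norm_nonneg _) ?_ 2
              refine (norm_sum_le _ _).trans_eq ?_
              simp
          _ ≤ _ := Finset.sum_mul_sq_le_sq_mul_sq _ _ _
    _ = _ := by rw [Finset.sum_mul]

lemma specRadius_nonneg {ι : Type} [Fintype ι] [DecidableEq ι] (M : Matrix ι ι ℝ) :
    0 ≤ specRadius M := ENNReal.toReal_nonneg

lemma specRadius_sq_le {ι : Type} [Fintype ι] [DecidableEq ι] (M : Matrix ι ι ℝ) :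
    specRadius M ^ 2 ≤ ∑ i, ∑ j, M i j ^ 2 := by
  have h0 : 0 ≤ ∑ i, ∑ j, M i j ^ 2 := by positivity
  have h : spectralRadius ℂ (M.map Complex.ofReal)
      ≤ ENNReal.ofReal (Real.sqrt (∑ i, ∑ j, M i j ^ 2)) := by
    refine iSup₂_le fun z hz => ?_
    rw [← enorm_eq_nnnorm, ← ofReal_norm]
    refine ENNReal.ofReal_le_ofReal (Real.le_sqrt_of_sq_le ?_)
    refine (norm_sq_le_of_mem_spectrum _ hz).trans_eq ?_
    simp
  have h2 : specRadius M ≤ Real.sqrt (∑ i, ∑ j, M i j ^ 2) :=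
    ENNReal.toReal_le_of_le_ofReal (Real.sqrt_nonneg _) h
  calc specRadius M ^ 2 ≤ Real.sqrt (∑ i, ∑ j, M i j ^ 2) ^ 2 :=
        pow_le_pow_left₀ (specRadius_nonneg M) h2 2
    _ = _ := Real.sq_sqrt h0

/-! ### The triad estimate -/

lemma sqLength_nonneg (k : Fin 3 → ℤ) : 0 ≤ sqLength k := by unfold sqLength; positivity

lemma sqLength_pos {k : Fin 3 → ℤ} (hk : k ≠ 0) : 0 < sqLength k := by
  obtain ⟨j, hj⟩ := Function.ne_iff.mp hk
  refine Finset.sum_pos' (fun _ _ => by positivity) ⟨j, Finset.mem_univ _, ?_⟩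
  have : (k j : ℝ) ≠ 0 := by exact_mod_cast hj
  positivity

/-- The enstrophy `|k|² |u_k|²` carried by the mode `k`. -/
def modeWeight (u : (Fin 3 → ℤ) → Fin 3 → ℂ) (k : Fin 3 → ℤ) : ℝ :=
  sqLength k * ∑ j, ‖u k j‖ ^ 2

lemma modeWeight_nonneg (u : (Fin 3 → ℤ) → Fin 3 → ℂ) (k : Fin 3 → ℤ) : 0 ≤ modeWeight u k :=
  mul_nonneg (sqLength_nonneg k) (by positivity)

lemma norm_dotProduct_sq_le {ι : Type*} [Fintype ι] (x y : ι → ℂ) :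
    ‖x ⬝ᵥ y‖ ^ 2 ≤ (∑ j, ‖x j‖ ^ 2) * ∑ j, ‖y j‖ ^ 2 := by
  calc ‖x ⬝ᵥ y‖ ^ 2 ≤ (∑ j, ‖x j‖ * ‖y j‖) ^ 2 := by
        refine pow_le_pow_left₀ (norm_nonneg _) ?_ 2
        refine (norm_sum_le _ _).trans_eq ?_
        simp
    _ ≤ _ := Finset.sum_mul_sq_le_sq_mul_sq _ _ _

/-- Pythagoras for the Leray projector, applied to an arbitrary complex vector. -/
lemma leray_mulVec_sum_sq {k : Fin 3 → ℤ} (hk : k ≠ 0) (g : Fin 3 → ℂ) :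
    ∑ j, ‖(leray k *ᵥ g) j‖ ^ 2
      = ∑ j, ‖g j‖ ^ 2 - ‖waveVec k ⬝ᵥ g‖ ^ 2 / sqLength k := by
  have hs : sqLength k ≠ 0 := (sqLength_pos hk).ne'
  set d := waveVec k ⬝ᵥ g with hd
  have hcoord : ∀ j, (leray k *ᵥ g) j = g j - ((sqLength k : ℂ)⁻¹ * d) * (k j : ℂ) := by
    intro j
    rw [leray, Matrix.sub_mulVec, Matrix.one_mulVec, Matrix.smul_mulVec, Matrix.vecMulVec_mulVec]
    simp [waveVec, ← hd]
    ring
  have hre : d.re = ∑ j, (k j : ℝ) * (g j).re := by simp [hd, dotProduct, waveVec]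
  have him : d.im = ∑ j, (k j : ℝ) * (g j).im := by simp [hd, dotProduct, waveVec]
  have hsq : sqLength k = ∑ j, (k j : ℝ) ^ 2 := rfl
  simp only [hcoord, Complex.sq_norm, Complex.normSq_apply]
  simp only [Complex.sub_re, Complex.sub_im, Complex.mul_re, Complex.mul_im, ← Complex.ofReal_inv,
    Complex.ofReal_re, Complex.ofReal_im, Complex.intCast_re, Complex.intCast_im]
  simp only [Fin.sum_univ_three] at hre him hsq ⊢
  field_simp
  generalize sqLength k = s at *
  rw [hre, him, hsq]
  ring

/-- The identity `|k|² |P(k)(k - p)|² = |k × (k - p)|² = |p × (k - p)|²` bounds the Leray projection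
in the triad by the lengths of the other two wave vectors. -/
lemma sqLength_mul_leray_waveVec_le {k : Fin 3 → ℤ} (hk : k ≠ 0) (p : Fin 3 → ℤ) :
    sqLength k * ∑ j, ‖(leray k *ᵥ waveVec (k - p)) j‖ ^ 2 ≤ sqLength p * sqLength (k - p) := by
  have hs : sqLength k ≠ 0 := (sqLength_pos hk).ne'
  have hd : waveVec k ⬝ᵥ waveVec (k - p) = ((∑ j, (k j : ℝ) * (k j - p j) : ℝ) : ℂ) := by
    simp [dotProduct, waveVec]
  have hn : ∑ j, ‖waveVec (k - p) j‖ ^ 2 = sqLength (k - p) := by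
    refine Finset.sum_congr rfl fun j _ => ?_
    rw [waveVec, Complex.norm_intCast, sq_abs]
  rw [leray_mulVec_sum_sq hk, hd, hn, Complex.norm_real, Real.norm_eq_abs, sq_abs, mul_sub,
    mul_div_cancel₀ _ hs]
  simp only [sqLength, Pi.sub_apply, Int.cast_sub, Fin.sum_univ_three]
  nlinarith [sq_nonneg ((p 0 : ℝ) * (k 0 - p 0) + p 1 * (k 1 - p 1) + p 2 * (k 2 - p 2))]

lemma triadTerm_sq_le (u : (Fin 3 → ℤ) → Fin 3 → ℂ) {k : Fin 3 → ℤ} (hk : k ≠ 0)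
    (p : Fin 3 → ℤ) :
    triadTerm u k p ^ 2 ≤ modeWeight u k * (modeWeight u p * modeWeight u (k - p)) := by
  set d := u p ⬝ᵥ u (k - p)
  have h1 : (star (u k) ⬝ᵥ interaction u k p).re ^ 2
      ≤ (∑ j, ‖u k j‖ ^ 2) * (‖d‖ ^ 2 * ∑ j, ‖(leray k *ᵥ waveVec (k - p)) j‖ ^ 2) := by
    calc (star (u k) ⬝ᵥ interaction u k p).re ^ 2
        ≤ ‖star (u k) ⬝ᵥ interaction u k p‖ ^ 2 := by
          rw [← sq_abs]
          exact pow_le_pow_left₀ (abs_nonneg _) (Complex.abs_re_le_norm _) 2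
      _ ≤ _ := norm_dotProduct_sq_le _ _
      _ = _ := by
          congr 1
          · simp
          · rw [Finset.mul_sum]
            refine Finset.sum_congr rfl fun j _ => ?_
            simp [interaction, Matrix.mulVec_smul, mul_pow, d]
  have h2 := norm_dotProduct_sq_le (u p) (u (k - p))
  have h3 := sqLength_mul_leray_waveVec_le hk p
  have hk0 := sqLength_nonneg k
  calc triadTerm u k p ^ 2
      = sqLength k ^ 2 * (star (u k) ⬝ᵥ interaction u k p).re ^ 2 := by rw [triadTerm, mul_pow]
    _ ≤ sqLength k ^ 2 * ((∑ j, ‖u k j‖ ^ 2)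
          * (‖d‖ ^ 2 * ∑ j, ‖(leray k *ᵥ waveVec (k - p)) j‖ ^ 2)) := by gcongr
    _ = modeWeight u k * (‖d‖ ^ 2
          * (sqLength k * ∑ j, ‖(leray k *ᵥ waveVec (k - p)) j‖ ^ 2)) := by
        rw [modeWeight]; ring
    _ ≤ modeWeight u k * (((∑ j, ‖u p j‖ ^ 2) * ∑ j, ‖u (k - p) j‖ ^ 2)
          * (sqLength p * sqLength (k - p))) := by
        have := modeWeight_nonneg u k
        gcongr
    _ = _ := by simp only [modeWeight]; ring

/-! ### The Frobenius norm of the stretching matrix -/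

lemma orbitModes_card_le (N : ℕ) (α : Orbit N) : (orbitModes N α).card ≤ 48 := by
  obtain ⟨k, rfl⟩ : ∃ k, orbitOf N k = α := Quotient.exists_rep α
  have hrep : ∀ l ∈ orbitModes N (orbitOf N k), ∃ x : Equiv.Perm (Fin 3) × (Fin 3 → ℤˣ),
      l.1 = fun i => (x.2 i : ℤ) * k.1 (x.1 i) := by
    intro l hl
    have hl' : orbitOf N l = orbitOf N k := (Finset.mem_filter.mp hl).2
    obtain ⟨σ, s, h⟩ := Quotient.exact hl'.symm
    exact ⟨(σ, s), funext h⟩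
  choose! f hf using hrep
  have hinj : Set.InjOn f (orbitModes N (orbitOf N k)) := fun l hl m hm h =>
    Subtype.ext (by rw [hf l hl, hf m hm, h])
  have hcard : Fintype.card (Equiv.Perm (Fin 3) × (Fin 3 → ℤˣ)) = 48 := by
    rw [Fintype.card_prod, Fintype.card_perm, Fintype.card_fun, Fintype.card_units_int,
      Fintype.card_fin]
    norm_num [Nat.factorial]
  calc (orbitModes N (orbitOf N k)).card
      ≤ (Finset.univ : Finset (Equiv.Perm (Fin 3) × (Fin 3 → ℤˣ))).card :=
        Finset.card_le_card_of_injOn f (fun _ _ => Finset.mem_univ _) hinj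
    _ = 48 := by rw [Finset.card_univ, hcard]

lemma transferMatrix_sq_le (N : ℕ) (u : (Fin 3 → ℤ) → Fin 3 → ℂ) (α β : Orbit N) :
    transferMatrix N u α β ^ 2 ≤ 48 * ∑ k ∈ orbitModes N α,
      ∑ p ∈ (orbitModes N β).filter (fun p => k.1 - p.1 ∈ lattice N),
        triadTerm u k.1 p.1 ^ 2 := by
  set T : lattice N → ℝ := fun k =>
    ∑ p ∈ (orbitModes N β).filter (fun p => k.1 - p.1 ∈ lattice N), triadTerm u k.1 p.1
  have hT : ∀ k : lattice N, T k ^ 2 ≤ 48 *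
      ∑ p ∈ (orbitModes N β).filter (fun p => k.1 - p.1 ∈ lattice N),
        triadTerm u k.1 p.1 ^ 2 := by
    intro k
    refine sq_sum_le_card_mul_sum_sq.trans ?_
    refine mul_le_mul_of_nonneg_right ?_ (by positivity)
    exact_mod_cast (Finset.card_filter_le _ _).trans (orbitModes_card_le N β)
  set n : ℝ := ((orbitModes N α).card : ℝ)
  -- The average over `Ω_α` is at most the sum, because `|Ω_α|⁻¹ ≤ 1` (also when read as `0⁻¹ = 0`).
  have hn : n⁻¹ ^ 2 * n ≤ 1 := by
    rcases Nat.eq_zero_or_pos (orbitModes N α).card with h | h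
    · simp [n, h]
    · have h1 : (1 : ℝ) ≤ n := Nat.one_le_cast.mpr h
      rw [sq, mul_assoc, inv_mul_cancel₀ (by positivity), mul_one]
      exact inv_le_one_of_one_le₀ h1
  calc transferMatrix N u α β ^ 2 = n⁻¹ ^ 2 * (∑ k ∈ orbitModes N α, T k) ^ 2 := by
        rw [← mul_pow]; rfl
    _ ≤ n⁻¹ ^ 2 * (n * ∑ k ∈ orbitModes N α, T k ^ 2) := by
        gcongr; exact sq_sum_le_card_mul_sum_sq
    _ = (n⁻¹ ^ 2 * n) * ∑ k ∈ orbitModes N α, T k ^ 2 := by ring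
    _ ≤ 1 * ∑ k ∈ orbitModes N α, T k ^ 2 := by gcongr
    _ ≤ _ := by
        rw [one_mul, Finset.mul_sum]
        exact Finset.sum_le_sum fun k _ => hT k

/-- Young's inequality for the convolution of a real weight with itself on the lattice. -/
lemma sum_convolution_le (N : ℕ) {w : (Fin 3 → ℤ) → ℝ} (k : Fin 3 → ℤ) :
    ∑ p ∈ (lattice N).filter (fun p => k - p ∈ lattice N), w p * w (k - p)
      ≤ ∑ p ∈ lattice N, w p ^ 2 := by
  set F := (lattice N).filter (fun p => k - p ∈ lattice N) with hF
  have hrefl : ∑ p ∈ F, w (k - p) ^ 2 = ∑ p ∈ F, w p ^ 2 := by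
    refine Finset.sum_nbij' (fun p => k - p) (fun p => k - p) ?_ ?_ ?_ ?_ ?_ <;>
      simp +contextual [hF]
  have hsub : ∑ p ∈ F, w p ^ 2 ≤ ∑ p ∈ lattice N, w p ^ 2 :=
    Finset.sum_le_sum_of_subset_of_nonneg (Finset.filter_subset _ _) fun _ _ _ => sq_nonneg _
  have : ∑ p ∈ F, w p * w (k - p) ≤ ∑ p ∈ F, (w p ^ 2 + w (k - p) ^ 2) / 2 :=
    Finset.sum_le_sum fun p _ => by nlinarith [sq_nonneg (w p - w (k - p))]
  rw [← Finset.sum_div, Finset.sum_add_distrib, hrefl] at this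
  linarith

lemma sum_transferMatrix_sq_le (N : ℕ) (u : (Fin 3 → ℤ) → Fin 3 → ℂ) :
    ∑ α, ∑ β, transferMatrix N u α β ^ 2
      ≤ 48 * ((∑ k ∈ lattice N, modeWeight u k) * ∑ p ∈ lattice N, modeWeight u p ^ 2) := by
  calc ∑ α, ∑ β, transferMatrix N u α β ^ 2
      ≤ ∑ α, ∑ β, 48 * ∑ k ∈ orbitModes N α,
          ∑ p ∈ (orbitModes N β).filter (fun p => k.1 - p.1 ∈ lattice N),
            triadTerm u k.1 p.1 ^ 2 :=
        Finset.sum_le_sum fun α _ => Finset.sum_le_sum fun β _ => transferMatrix_sq_le N u α β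
    _ = 48 * ∑ k : lattice N, ∑ p : lattice N,
          if k.1 - p.1 ∈ lattice N then triadTerm u k.1 p.1 ^ 2 else 0 := by
        simp_rw [← Finset.mul_sum, Finset.sum_filter]
        congr 1
        calc _ = ∑ α, ∑ k ∈ orbitModes N α, ∑ β, ∑ p ∈ orbitModes N β,
              (if k.1 - p.1 ∈ lattice N then triadTerm u k.1 p.1 ^ 2 else 0) :=
              Finset.sum_congr rfl fun α _ => Finset.sum_comm
          _ = _ := by
              rw [← Finset.sum_fiberwise (s := Finset.univ) (g := orbitOf N)]
              refine Finset.sum_congr rfl fun α _ => Finset.sum_congr rfl fun k _ => ?_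
              rw [← Finset.sum_fiberwise (s := Finset.univ) (g := orbitOf N)]
              rfl
    _ = 48 * ∑ k ∈ lattice N, ∑ p ∈ (lattice N).filter (fun p => k - p ∈ lattice N),
          triadTerm u k p ^ 2 := by
        simp_rw [Finset.sum_filter]
        rw [← Finset.sum_coe_sort (lattice N)]
        congr 1
        refine Finset.sum_congr rfl fun k _ => ?_
        rw [← Finset.sum_coe_sort (lattice N)]
    _ ≤ 48 * ∑ k ∈ lattice N, modeWeight u k * ∑ p ∈ lattice N, modeWeight u p ^ 2 := by
        refine mul_le_mul_of_nonneg_left (Finset.sum_le_sum fun k hk => ?_) (by norm_num)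
        have hk0 : k ≠ 0 := (Finset.mem_erase.mp hk).1
        calc _ ≤ ∑ p ∈ (lattice N).filter (fun p => k - p ∈ lattice N),
              modeWeight u k * (modeWeight u p * modeWeight u (k - p)) :=
              Finset.sum_le_sum fun p _ => triadTerm_sq_le u hk0 p
          _ ≤ _ := by
              rw [← Finset.mul_sum]
              exact mul_le_mul_of_nonneg_left (sum_convolution_le N k) (modeWeight_nonneg u k)
    _ = _ := by rw [Finset.sum_mul]

lemma specRadius_stretchingMatrix_sq_le (N : ℕ) (u : (Fin 3 → ℤ) → Fin 3 → ℂ) :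
    specRadius (stretchingMatrix N u) ^ 2
      ≤ 48 * ((∑ k ∈ lattice N, modeWeight u k) * ∑ p ∈ lattice N, modeWeight u p ^ 2) := by
  set S := transferMatrix N u with hS
  calc specRadius (stretchingMatrix N u) ^ 2
      ≤ ∑ α, ∑ β, stretchingMatrix N u α β ^ 2 := specRadius_sq_le _
    _ ≤ ∑ α, ∑ β, (S α β ^ 2 + S β α ^ 2) / 2 := by
        refine Finset.sum_le_sum fun α _ => Finset.sum_le_sum fun β _ => ?_
        simp only [stretchingMatrix, ← hS, Matrix.smul_apply, Matrix.add_apply,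
          Matrix.transpose_apply, smul_eq_mul]
        nlinarith [sq_nonneg (S α β - S β α)]
    _ = ∑ α, ∑ β, S α β ^ 2 := by
        simp_rw [← Finset.sum_div, Finset.sum_add_distrib]
        rw [Finset.sum_comm (f := fun α β => S β α ^ 2)]
        ring
    _ ≤ _ := sum_transferMatrix_sq_le N u

/-! ### Measurability of the spectral radius -/

open Filter Topology in
/-- By Gelfand's formula the spectral radius is a limit of measurable functions of the entries. -/
lemma measurable_specRadius {Ω ι : Type} [MeasurableSpace Ω] [Fintype ι] [DecidableEq ι]
    {M : Ω → Matrix ι ι ℝ} (hM : ∀ i j, Measurable fun ω => M ω i j) :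
    Measurable fun ω => specRadius (M ω) := by
  let _ : NormedRing (Matrix ι ι ℂ) := Matrix.linftyOpNormedRing
  let _ : NormedAlgebra ℂ (Matrix ι ι ℂ) := Matrix.linftyOpNormedAlgebra
  have _ : CompleteSpace (Matrix ι ι ℂ) := FiniteDimensional.complete ℂ _
  have hpow : ∀ n i j, Measurable fun ω => ((M ω).map Complex.ofReal ^ n) i j := by
    intro n
    induction n with
    | zero => intro i j; simp only [pow_zero]; exact measurable_const
    | succ n ih =>
      intro i j
      simp only [pow_succ, Matrix.mul_apply, Matrix.map_apply]
      exact Finset.measurable_sum _ fun l _ =>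
        (ih i l).mul (Complex.measurable_ofReal.comp (hM l j))
  have hnorm : ∀ n, Measurable fun ω => ‖(M ω).map Complex.ofReal ^ n‖₊ := by
    intro n
    simp only [Matrix.linfty_opNNNorm_def]
    generalize hF : (fun i ω => ∑ j, ‖((M ω).map Complex.ofReal ^ n) i j‖₊) = F
    have hFm : ∀ i, Measurable (F i) := fun i => by
      rw [← hF]
      exact Finset.measurable_sum _ fun j _ => (hpow n i j).nnnorm
    change Measurable fun ω => Finset.univ.sup fun i => (fun i ω =>
      ∑ j, ‖((M ω).map Complex.ofReal ^ n) i j‖₊) i ω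
    rw [hF]
    refine Finset.induction_on Finset.univ measurable_const fun i s _ ih => ?_
    simp only [Finset.sup_insert]
    exact (hFm i).sup ih
  refine ENNReal.measurable_toReal.comp ?_
  refine measurable_of_tendsto_metrizable (f := fun (n : ℕ) ω =>
    ((‖(M ω).map Complex.ofReal ^ n‖₊ : ENNReal) ^ (1 / n : ℝ))) (fun n => ?_) ?_
  · exact (hnorm n).coe_nnreal_ennreal.pow_const _
  · exact tendsto_pi_nhds.mpr fun ω =>
      spectrum.pow_nnnorm_pow_one_div_tendsto_nhds_spectralRadius _

lemma measurable_gaussianVec (N : ℕ) (k : Fin 3 → ℤ) (j : Fin 3) :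
    Measurable fun ω => gaussianVec N ω k j := by
  unfold gaussianVec
  split_ifs <;> fun_prop

lemma measurable_leray_mulVec_gaussianVec (N : ℕ) (k : Fin 3 → ℤ) (j : Fin 3) :
    Measurable fun ω => (leray k *ᵥ gaussianVec N ω k) j := by
  simp only [Matrix.mulVec, dotProduct]
  exact Finset.measurable_sum _ fun i _ => (measurable_gaussianVec N k i).const_mul _

lemma measurable_rawField (N a : ℕ) (k : Fin 3 → ℤ) (j : Fin 3) :
    Measurable fun ω => rawField N a ω k j := by
  have h : ∀ k, Measurable fun ω => projectedVec N a ω k j := fun k => by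
    simp only [projectedVec, Pi.smul_apply, smul_eq_mul]
    exact (measurable_leray_mulVec_gaussianVec N k j).const_mul _
  unfold rawField
  split_ifs
  · exact h k
  · simp only [Pi.star_apply]
    exact Complex.continuous_conj.measurable.comp (h (-k))

lemma measurable_ensembleField (N a : ℕ) (k : Fin 3 → ℤ) (j : Fin 3) :
    Measurable fun ω => ensembleField N a ω k j := by
  have hE : Measurable fun ω => energy N (rawField N a ω) := by
    unfold energy
    refine Measurable.const_mul (Finset.measurable_sum _ fun k _ => ?_) _
    refine Measurable.const_mul (Finset.measurable_sum _ fun j _ => ?_) _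
    exact (measurable_rawField N a k j).norm.pow_const 2
  simp only [ensembleField, Pi.smul_apply, smul_eq_mul]
  exact (Complex.measurable_ofReal.comp hE.sqrt).inv.mul (measurable_rawField N a k j)

lemma measurable_triadTerm (N a : ℕ) (k p : Fin 3 → ℤ) :
    Measurable fun ω => triadTerm (ensembleField N a ω) k p := by
  have hd : Measurable fun ω => ensembleField N a ω p ⬝ᵥ ensembleField N a ω (k - p) := by
    simp only [dotProduct]
    exact Finset.measurable_sum _ fun j _ =>
      (measurable_ensembleField N a p j).mul (measurable_ensembleField N a (k - p) j)
  simp only [triadTerm, interaction, Matrix.mulVec_smul, dotProduct, Pi.smul_apply, Pi.star_apply,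
    smul_eq_mul] at hd ⊢
  refine Measurable.const_mul (Complex.measurable_re.comp (Finset.measurable_sum _ fun j _ => ?_)) _
  exact (Complex.continuous_conj.measurable.comp (measurable_ensembleField N a k j)).mul
    ((hd.mul_const _).const_mul _)

lemma measurable_rho (N a : ℕ) : Measurable (rho N a) := by
  have hS : ∀ α β, Measurable fun ω => transferMatrix N (ensembleField N a ω) α β := fun α β => by
    simp only [transferMatrix, Matrix.of_apply]
    exact Measurable.const_mul (Finset.measurable_sum _ fun k _ =>
      Finset.measurable_sum _ fun p _ => measurable_triadTerm N a k.1 p.1) _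
  refine measurable_specRadius fun α β => ?_
  simp only [stretchingMatrix, Matrix.smul_apply, Matrix.add_apply, Matrix.transpose_apply,
    smul_eq_mul]
  exact ((hS α β).add (hS β α)).const_mul _

/-! ### Moments of the Gaussian coordinates -/

instance instIsProbabilityMeasureGaussianLaw (N : ℕ) : IsProbabilityMeasure (gaussianLaw N) := by
  unfold gaussianLaw; infer_instance

/-- The fourth moment of a centred real Gaussian variable of variance `1/2`. Only its finiteness
matters. -/
def fourthMoment : ℝ := ∫ x, x ^ 4 ∂(gaussianReal 0 (1 / 2))

lemma fourthMoment_nonneg : 0 ≤ fourthMoment := integral_nonneg fun x => by positivity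

lemma memLp_coord (N : ℕ) (i : halfLattice N × Fin 3 × Fin 2) {p : ENNReal} (hp : p ≠ ⊤) :
    MemLp (fun ω : Sample N => ω i) p (gaussianLaw N) :=
  (memLp_id_gaussianReal' p hp).comp_measurePreserving
    (measurePreserving_eval (fun _ => gaussianReal 0 (1 / 2)) i)

lemma integrable_coord_mul (N : ℕ) (i j : halfLattice N × Fin 3 × Fin 2) :
    Integrable (fun ω : Sample N => ω i * ω j) (gaussianLaw N) :=
  MemLp.integrable_mul (p := 2) (q := 2) (memLp_coord N i ENNReal.ofNat_ne_top) (memLp_coord N j ENNReal.ofNat_ne_top)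

lemma iIndepFun_coord (N : ℕ) :
    iIndepFun (fun i (ω : Sample N) => ω i) (gaussianLaw N) :=
  iIndepFun_pi (X := fun _ x => x) fun _ => aemeasurable_id'

lemma integral_comp_coord (N : ℕ) (i : halfLattice N × Fin 3 × Fin 2) {f : ℝ → ℝ}
    (hf : Measurable f) :
    ∫ ω : Sample N, f (ω i) ∂(gaussianLaw N) = ∫ x, f x ∂(gaussianReal 0 (1 / 2)) :=
  integral_comp_eval (X := fun _ => ℝ) (μ := fun _ => gaussianReal 0 (1 / 2)) (i := i)
    hf.aestronglyMeasurable

lemma integral_coord (N : ℕ) (i : halfLattice N × Fin 3 × Fin 2) :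
    ∫ ω : Sample N, ω i ∂(gaussianLaw N) = 0 := by
  rw [integral_comp_coord N i (f := fun x : ℝ => x) measurable_id', integral_id_gaussianReal]

lemma integral_coord_mul (N : ℕ) (i j : halfLattice N × Fin 3 × Fin 2) :
    ∫ ω : Sample N, ω i * ω j ∂(gaussianLaw N) = if i = j then 1 / 2 else 0 := by
  split_ifs with h
  · subst h
    rw [integral_comp_coord N i (f := fun x : ℝ => x * x) (by fun_prop)]
    have h := variance_fun_id_gaussianReal (μ := 0) (v := 1 / 2)
    rw [variance_eq_integral (by fun_prop), integral_id_gaussianReal] at h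
    simpa [sq] using h
  · rw [((iIndepFun_coord N).indepFun h).integral_fun_mul_eq_mul_integral
      (memLp_coord N i ENNReal.one_ne_top).1 (memLp_coord N j ENNReal.one_ne_top).1,
      integral_coord, zero_mul]

lemma integrable_coord_pow_four (N : ℕ) (i : halfLattice N × Fin 3 × Fin 2) :
    Integrable (fun ω : Sample N => ω i ^ 4) (gaussianLaw N) := by
  have h := (memLp_coord N i (p := (4 : ℕ)) (by simp)).integrable_norm_pow (by norm_num)
  simpa [Real.norm_eq_abs, Even.pow_abs (show Even 4 by decide)] using h

lemma integral_coord_pow_four (N : ℕ) (i : halfLattice N × Fin 3 × Fin 2) :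
    ∫ ω : Sample N, ω i ^ 4 ∂(gaussianLaw N) = fourthMoment :=
  integral_comp_coord N i (f := fun x : ℝ => x ^ 4) (by fun_prop)

/-! ### Moments and independence of the projected Gaussian vectors -/

/-- The squared length `|P(k) g_k|²` of the projected Gaussian vector. -/
def projSq (N : ℕ) (k : Fin 3 → ℤ) (ω : Sample N) : ℝ :=
  ∑ j, ‖(leray k *ᵥ gaussianVec N ω k) j‖ ^ 2

lemma projSq_nonneg (N : ℕ) (k : Fin 3 → ℤ) (ω : Sample N) : 0 ≤ projSq N k ω := by
  unfold projSq; positivity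

lemma measurable_projSq (N : ℕ) (k : Fin 3 → ℤ) : Measurable (projSq N k) :=
  Finset.measurable_sum _ fun j _ => (measurable_leray_mulVec_gaussianVec N k j).norm.pow_const 2

lemma ne_zero_of_mem_lattice {N : ℕ} {k : Fin 3 → ℤ} (hk : k ∈ lattice N) : k ≠ 0 :=
  (Finset.mem_erase.mp hk).1

lemma mem_lattice_of_mem_halfLattice {N : ℕ} {k : Fin 3 → ℤ} (hk : k ∈ halfLattice N) :
    k ∈ lattice N := (Finset.mem_filter.mp hk).1

/-- The real and the imaginary part of the Gaussian vector are projected separately. -/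
lemma projSq_eq {N : ℕ} {k : Fin 3 → ℤ} (hk : k ∈ halfLattice N) (ω : Sample N) :
    projSq N k ω = ∑ b, (∑ j, ω (⟨k, hk⟩, j, b) ^ 2
      - (∑ j, (k j : ℝ) * ω (⟨k, hk⟩, j, b)) ^ 2 / sqLength k) := by
  rw [projSq, leray_mulVec_sum_sq (ne_zero_of_mem_lattice (mem_lattice_of_mem_halfLattice hk))]
  simp only [gaussianVec, hk, dif_pos, dotProduct, waveVec, Complex.sq_norm, Complex.normSq_apply,
    Fin.sum_univ_three, Fin.sum_univ_two]
  simp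
  ring

lemma integral_projSq {N : ℕ} {k : Fin 3 → ℤ} (hk : k ∈ halfLattice N) :
    ∫ ω, projSq N k ω ∂(gaussianLaw N) = 2 := by
  have hs := sqLength_pos (ne_zero_of_mem_lattice (mem_lattice_of_mem_halfLattice hk))
  have hform : ∀ ω, projSq N k ω = ∑ b, (∑ j, ω (⟨k, hk⟩, j, b) * ω (⟨k, hk⟩, j, b)
      - (sqLength k)⁻¹ * ∑ i, ∑ j, ((k i : ℝ) * k j)
        * (ω (⟨k, hk⟩, i, b) * ω (⟨k, hk⟩, j, b))) := by
    intro ω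
    rw [projSq_eq hk]
    refine Finset.sum_congr rfl fun b _ => ?_
    rw [sq (∑ j, (k j : ℝ) * _), Finset.sum_mul_sum, div_eq_inv_mul]
    congr 1
    · exact Finset.sum_congr rfl fun j _ => sq _
    · congr 1
      exact Finset.sum_congr rfl fun i _ => Finset.sum_congr rfl fun j _ => by ring
  have hI := integrable_coord_mul N
  have hI2 : ∀ b, Integrable (fun ω : Sample N => ∑ j, ω (⟨k, hk⟩, j, b) * ω (⟨k, hk⟩, j, b))
      (gaussianLaw N) := fun b => integrable_finsetSum _ fun j _ => hI _ _
  have hI3 : ∀ b, Integrable (fun ω : Sample N => ∑ i, ∑ j, ((k i : ℝ) * k j)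
      * (ω (⟨k, hk⟩, i, b) * ω (⟨k, hk⟩, j, b))) (gaussianLaw N) := fun b =>
    integrable_finsetSum _ fun i _ => integrable_finsetSum _ fun j _ => (hI _ _).const_mul _
  have hI4 : ∀ b, Integrable (fun ω : Sample N => ∑ j, ω (⟨k, hk⟩, j, b) * ω (⟨k, hk⟩, j, b)
      - (sqLength k)⁻¹ * ∑ i, ∑ j, ((k i : ℝ) * k j)
        * (ω (⟨k, hk⟩, i, b) * ω (⟨k, hk⟩, j, b))) (gaussianLaw N) :=
    fun b => (hI2 b).sub ((hI3 b).const_mul _)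
  simp_rw [hform]
  rw [integral_finsetSum _ fun b _ => hI4 b]
  have hb : ∀ b, ∫ ω : Sample N, (∑ j, ω (⟨k, hk⟩, j, b) * ω (⟨k, hk⟩, j, b)
      - (sqLength k)⁻¹ * ∑ i, ∑ j, ((k i : ℝ) * k j)
        * (ω (⟨k, hk⟩, i, b) * ω (⟨k, hk⟩, j, b))) ∂(gaussianLaw N) = 1 := by
    intro b
    rw [integral_sub (hI2 b) ((hI3 b).const_mul _), integral_const_mul,
      integral_finsetSum _ fun j _ => hI _ _,
      integral_finsetSum _ fun i _ => integrable_finsetSum _ fun j _ => (hI _ _).const_mul _]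
    have hi : ∀ i, ∫ ω : Sample N, ∑ j, ((k i : ℝ) * k j)
        * (ω (⟨k, hk⟩, i, b) * ω (⟨k, hk⟩, j, b)) ∂(gaussianLaw N) = (k i : ℝ) ^ 2 / 2 := by
      intro i
      rw [integral_finsetSum _ fun j _ => (hI _ _).const_mul _]
      simp only [integral_const_mul, integral_coord_mul, Prod.mk.injEq, true_and, and_true,
        mul_ite, mul_zero, Finset.sum_ite_eq, Finset.mem_univ, if_true]
      ring
    simp only [hi, integral_coord_mul, if_true]
    rw [← Finset.sum_div Finset.univ fun i => (k i : ℝ) ^ 2]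
    change _ - (sqLength k)⁻¹ * (sqLength k / 2) = 1
    field_simp
    norm_num
  rw [Finset.sum_congr rfl fun b _ => hb b]
  norm_num

lemma projSq_of_notMem {N : ℕ} {k : Fin 3 → ℤ} (hk : k ∉ halfLattice N) (ω : Sample N) :
    projSq N k ω = 0 := by
  have : gaussianVec N ω k = 0 := by ext j; simp [gaussianVec, hk]
  simp [projSq, this]

lemma projSq_sq_le {N : ℕ} {k : Fin 3 → ℤ} (hk : k ∈ halfLattice N) (ω : Sample N) :
    projSq N k ω ^ 2 ≤ 6 * ∑ x : Fin 3 × Fin 2, ω (⟨k, hk⟩, x) ^ 4 := by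
  have h1 : projSq N k ω ≤ ∑ x : Fin 3 × Fin 2, ω (⟨k, hk⟩, x) ^ 2 := by
    rw [projSq_eq hk, Fintype.sum_prod_type_right]
    exact Finset.sum_le_sum fun b _ =>
      sub_le_self _ (div_nonneg (sq_nonneg _) (sqLength_nonneg k))
  calc projSq N k ω ^ 2 ≤ (∑ x : Fin 3 × Fin 2, ω (⟨k, hk⟩, x) ^ 2) ^ 2 :=
        pow_le_pow_left₀ (projSq_nonneg N k ω) h1 2
    _ ≤ ((Finset.univ : Finset (Fin 3 × Fin 2)).card : ℝ)
          * ∑ x : Fin 3 × Fin 2, (ω (⟨k, hk⟩, x) ^ 2) ^ 2 := sq_sum_le_card_mul_sum_sq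
    _ = _ := by
        simp only [← pow_mul]
        norm_num [Finset.card_univ, Fintype.card_prod]

lemma memLp_projSq (N : ℕ) (k : Fin 3 → ℤ) : MemLp (projSq N k) 2 (gaussianLaw N) := by
  by_cases hk : k ∈ halfLattice N
  · rw [memLp_two_iff_integrable_sq (measurable_projSq N k).aestronglyMeasurable]
    refine Integrable.mono' ((integrable_finsetSum Finset.univ fun x _ =>
      integrable_coord_pow_four N (⟨k, hk⟩, x)).const_mul 6)
      ((measurable_projSq N k).pow_const 2).aestronglyMeasurable (.of_forall fun ω => ?_)
    rw [Real.norm_of_nonneg (sq_nonneg _)]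
    exact projSq_sq_le hk ω
  · rw [funext (projSq_of_notMem hk)]
    exact MemLp.zero'

lemma integral_projSq_sq_le (N : ℕ) (k : Fin 3 → ℤ) :
    ∫ ω, projSq N k ω ^ 2 ∂(gaussianLaw N) ≤ 36 * fourthMoment := by
  by_cases hk : k ∈ halfLattice N
  · have hI := integrable_finsetSum (Finset.univ : Finset (Fin 3 × Fin 2)) fun x _ =>
      integrable_coord_pow_four N (⟨k, hk⟩, x)
    refine (integral_mono (memLp_projSq N k).integrable_sq (hI.const_mul 6)
      fun ω => projSq_sq_le hk ω).trans_eq ?_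
    rw [integral_const_mul, integral_finsetSum _ fun x _ => integrable_coord_pow_four N _]
    simp only [integral_coord_pow_four, Finset.sum_const, Finset.card_univ, Fintype.card_prod,
      Fintype.card_fin, nsmul_eq_mul]
    norm_num
    ring
  · simp only [projSq_of_notMem hk]
    simpa using fourthMoment_nonneg

/-- The projected vectors at different modes of the half-lattice are functions of disjoint blocks
of coordinates. -/
lemma indepFun_projSq (N : ℕ) {k l : Fin 3 → ℤ} (hkl : k ≠ l) :
    IndepFun (projSq N k) (projSq N l) (gaussianLaw N) := by
  classical
  let S : (Fin 3 → ℤ) → Finset (halfLattice N × Fin 3 × Fin 2) :=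
    fun k => Finset.univ.filter fun i => i.1.1 = k
  let ext : ∀ k, (S k → ℝ) → Sample N := fun k y i => if h : i ∈ S k then y ⟨i, h⟩ else 0
  have hext : ∀ k, Measurable (ext k) := fun k => measurable_pi_lambda _ fun i => by
    simp only [ext]
    split_ifs <;> fun_prop
  have hfac : ∀ k, projSq N k = (projSq N k ∘ ext k) ∘ fun ω (i : S k) => ω i := by
    intro k
    funext ω
    have : gaussianVec N (ext k fun i => ω i) k = gaussianVec N ω k := by
      funext j
      by_cases h : k ∈ halfLattice N <;> simp [gaussianVec, h, ext, S]
    simp only [projSq, Function.comp_apply, this]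
  have hdisj : Disjoint (S k) (S l) := Finset.disjoint_left.mpr fun i hi hi' =>
    hkl ((Finset.mem_filter.mp hi).2.symm.trans (Finset.mem_filter.mp hi').2)
  rw [hfac k, hfac l]
  exact ((iIndepFun_coord N).indepFun_finset (S k) (S l) hdisj fun i => measurable_pi_apply i).comp
    ((measurable_projSq N k).comp (hext k)) ((measurable_projSq N l).comp (hext l))

/-! ### The random energy -/

/-- The weight `|k|^{2 - 2a}` with which `|P(k) g_k|²` enters the energy. -/
def energyScale (a : ℕ) (k : Fin 3 → ℤ) : ℝ := sqLength k / (Real.sqrt (sqLength k) ^ a) ^ 2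

lemma energyScale_nonneg (a : ℕ) (k : Fin 3 → ℤ) : 0 ≤ energyScale a k :=
  div_nonneg (sqLength_nonneg k) (sq_nonneg _)

lemma energyScale_of_zero (k : Fin 3 → ℤ) : energyScale 0 k = sqLength k := by
  simp [energyScale]

lemma energyScale_of_one {k : Fin 3 → ℤ} (hk : k ≠ 0) : energyScale 1 k = 1 := by
  rw [energyScale, pow_one, Real.sq_sqrt (sqLength_nonneg k), div_self (sqLength_pos hk).ne']

lemma sqLength_neg (k : Fin 3 → ℤ) : sqLength (-k) = sqLength k := by simp [sqLength]

lemma energyScale_le {a : ℕ} (ha : a = 0 ∨ a = 1) {N : ℕ} {k : Fin 3 → ℤ} (hk : k ∈ lattice N) :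
    energyScale a k ≤ 3 * (N : ℝ) ^ (2 - 2 * a) := by
  rcases ha with rfl | rfl
  · rw [energyScale_of_zero]
    have hbox := Fintype.mem_piFinset.mp (Finset.mem_erase.mp hk).2
    calc sqLength k ≤ ∑ _i : Fin 3, (N : ℝ) ^ 2 := by
          refine Finset.sum_le_sum fun i _ => sq_le_sq' ?_ ?_
          · exact_mod_cast (Finset.mem_Icc.mp (hbox i)).1
          · exact_mod_cast (Finset.mem_Icc.mp (hbox i)).2
      _ = _ := by simp
  · rw [energyScale_of_one (ne_zero_of_mem_lattice hk)]
    norm_num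

/-- The cube of the modes whose coordinates all lie in the upper half of `[0, N]`. -/
def upperCube (N : ℕ) : Finset (Fin 3 → ℤ) :=
  Fintype.piFinset fun _ => Finset.Icc ((N : ℤ) - (N / 2 : ℕ)) N

lemma upperCube_subset {N : ℕ} (hN : 1 ≤ N) : upperCube N ⊆ halfLattice N := by
  intro k hk
  have hbox : ∀ i, ((N : ℤ) - (N / 2 : ℕ)) ≤ k i ∧ k i ≤ N := fun i =>
    Finset.mem_Icc.mp (Fintype.mem_piFinset.mp hk i)
  have h0 : 0 < k 0 := by have := (hbox 0).1; omega
  refine Finset.mem_filter.mpr ⟨Finset.mem_erase.mpr ⟨?_, ?_⟩, Or.inl h0⟩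
  · rintro rfl
    exact lt_irrefl _ h0
  · refine Fintype.mem_piFinset.mpr fun i => Finset.mem_Icc.mpr ?_
    have := hbox i
    omega

lemma le_card_upperCube (N : ℕ) : ((N : ℝ) / 2) ^ 3 ≤ (upperCube N).card := by
  have h : (upperCube N).card = (N / 2 + 1) ^ 3 := by
    rw [upperCube, Fintype.card_piFinset_const, Int.card_Icc]
    congr 1
    omega
  rw [h]
  push_cast
  refine pow_le_pow_left₀ (by positivity) ?_ 3
  have : N ≤ 2 * (N / 2 + 1) := by omega
  have : (N : ℝ) ≤ 2 * ((N / 2 : ℕ) + 1) := by exact_mod_cast this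
  linarith

lemma le_energyScale {a : ℕ} (ha : a = 0 ∨ a = 1) {N : ℕ} (hN : 1 ≤ N) {k : Fin 3 → ℤ}
    (hk : k ∈ upperCube N) : (N : ℝ) ^ (2 - 2 * a) / 2 ≤ energyScale a k := by
  rcases ha with rfl | rfl
  · rw [energyScale_of_zero]
    have hbox : ∀ i, (N : ℝ) / 2 ≤ k i := fun i => by
      have h1 := (Finset.mem_Icc.mp (Fintype.mem_piFinset.mp hk i)).1
      have h2 : (N : ℤ) ≤ 2 * k i := by omega
      have h3 : (N : ℝ) ≤ 2 * k i := by exact_mod_cast h2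
      linarith
    calc (N : ℝ) ^ (2 - 2 * 0) / 2 ≤ ∑ _i : Fin 3, ((N : ℝ) / 2) ^ 2 := by
          simp only [Finset.sum_const, Finset.card_univ, Fintype.card_fin, nsmul_eq_mul]
          norm_num
          nlinarith [sq_nonneg (N : ℝ)]
      _ ≤ _ := Finset.sum_le_sum fun i _ => pow_le_pow_left₀ (by positivity) (hbox i) 2
  · rw [energyScale_of_one (ne_zero_of_mem_lattice
      (mem_lattice_of_mem_halfLattice (upperCube_subset hN hk)))]
    norm_num

lemma card_lattice_le {N : ℕ} (hN : 1 ≤ N) : ((lattice N).card : ℝ) ≤ 27 * (N : ℝ) ^ 3 := by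
  have h : (lattice N).card ≤ (2 * N + 1) ^ 3 := by
    refine (Finset.card_le_card (Finset.erase_subset _ _)).trans_eq ?_
    rw [Fintype.card_piFinset_const, Int.card_Icc]
    congr 1
    omega
  have h1 : (1 : ℝ) ≤ N := by exact_mod_cast hN
  calc ((lattice N).card : ℝ) ≤ (2 * (N : ℝ) + 1) ^ 3 := by exact_mod_cast h
    _ ≤ (3 * (N : ℝ)) ^ 3 := pow_le_pow_left₀ (by positivity) (by linarith) 3
    _ = _ := by ring

lemma sum_energyScale_sq_le {a : ℕ} (ha : a = 0 ∨ a = 1) {N : ℕ} (hN : 1 ≤ N) :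
    ∑ k ∈ lattice N, energyScale a k ^ 2 ≤ 243 * ((N : ℝ) ^ 3 * ((N : ℝ) ^ (2 - 2 * a)) ^ 2) := by
  calc ∑ k ∈ lattice N, energyScale a k ^ 2
      ≤ ∑ _k ∈ lattice N, (3 * (N : ℝ) ^ (2 - 2 * a)) ^ 2 := Finset.sum_le_sum fun k hk =>
        pow_le_pow_left₀ (energyScale_nonneg a k) (energyScale_le ha hk) 2
    _ = (lattice N).card * (9 * ((N : ℝ) ^ (2 - 2 * a)) ^ 2) := by
        rw [Finset.sum_const, nsmul_eq_mul, mul_pow]; norm_num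
    _ ≤ 27 * (N : ℝ) ^ 3 * (9 * ((N : ℝ) ^ (2 - 2 * a)) ^ 2) := by
        gcongr; exact card_lattice_le hN
    _ = _ := by ring

/-- The part of twice the energy carried by the modes of the half-lattice. -/
def halfEnergy (N a : ℕ) (ω : Sample N) : ℝ :=
  ∑ k ∈ halfLattice N, energyScale a k * projSq N k ω

/-- The expectation of `halfEnergy`. -/
def meanHalfEnergy (N a : ℕ) : ℝ := ∑ k ∈ halfLattice N, energyScale a k * 2

lemma memLp_halfEnergy (N a : ℕ) : MemLp (halfEnergy N a) 2 (gaussianLaw N) :=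
  memLp_finsetSum _ fun k _ => (memLp_projSq N k).const_mul _

lemma integral_halfEnergy (N a : ℕ) :
    ∫ ω, halfEnergy N a ω ∂(gaussianLaw N) = meanHalfEnergy N a := by
  unfold halfEnergy meanHalfEnergy
  rw [integral_finsetSum _ fun k _ => ((memLp_projSq N k).integrable one_le_two).const_mul _]
  exact Finset.sum_congr rfl fun k hk => by rw [integral_const_mul, integral_projSq hk]

lemma le_meanHalfEnergy {a : ℕ} (ha : a = 0 ∨ a = 1) {N : ℕ} (hN : 1 ≤ N) :
    (N : ℝ) ^ 3 * (N : ℝ) ^ (2 - 2 * a) / 8 ≤ meanHalfEnergy N a := by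
  calc (N : ℝ) ^ 3 * (N : ℝ) ^ (2 - 2 * a) / 8
      = ((N : ℝ) / 2) ^ 3 * (N : ℝ) ^ (2 - 2 * a) := by ring
    _ ≤ (upperCube N).card * (N : ℝ) ^ (2 - 2 * a) := by gcongr; exact le_card_upperCube N
    _ = ∑ _k ∈ upperCube N, (N : ℝ) ^ (2 - 2 * a) := by rw [Finset.sum_const, nsmul_eq_mul]
    _ ≤ ∑ k ∈ upperCube N, energyScale a k * 2 := Finset.sum_le_sum fun k hk => by
        have := le_energyScale ha hN hk; linarith
    _ ≤ _ := Finset.sum_le_sum_of_subset_of_nonneg (upperCube_subset hN) fun k _ _ =>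
        mul_nonneg (energyScale_nonneg a k) (by norm_num)

lemma integral_halfEnergy_sub_sq_le {a : ℕ} (ha : a = 0 ∨ a = 1) {N : ℕ} (hN : 1 ≤ N) :
    ∫ ω, (halfEnergy N a ω - meanHalfEnergy N a) ^ 2 ∂(gaussianLaw N)
      ≤ 243 * ((N : ℝ) ^ 3 * ((N : ℝ) ^ (2 - 2 * a)) ^ 2) * (36 * fourthMoment) := by
  have hvar := variance_eq_integral (memLp_halfEnergy N a).aemeasurable
  rw [integral_halfEnergy] at hvar
  rw [← hvar]
  have hsum : halfEnergy N a = ∑ k ∈ halfLattice N, fun ω => energyScale a k * projSq N k ω := by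
    funext ω; simp [halfEnergy]
  rw [hsum, IndepFun.variance_sum (fun k _ => (memLp_projSq N k).const_mul _)
    fun k _ l _ hkl => (indepFun_projSq N hkl).comp (measurable_const_mul _)
      (measurable_const_mul _)]
  calc ∑ k ∈ halfLattice N, Var[fun ω => energyScale a k * projSq N k ω; gaussianLaw N]
      ≤ ∑ k ∈ halfLattice N, energyScale a k ^ 2 * (36 * fourthMoment) := by
        refine Finset.sum_le_sum fun k _ => ?_
        rw [variance_const_mul]
        exact mul_le_mul_of_nonneg_left ((variance_le_expectation_sq
          (measurable_projSq N k).aestronglyMeasurable).trans (integral_projSq_sq_le N k))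
          (sq_nonneg _)
    _ ≤ ∑ k ∈ lattice N, energyScale a k ^ 2 * (36 * fourthMoment) :=
        Finset.sum_le_sum_of_subset_of_nonneg (Finset.filter_subset _ _) fun k _ _ =>
          mul_nonneg (sq_nonneg _) (mul_nonneg (by norm_num) fourthMoment_nonneg)
    _ ≤ _ := by
        rw [← Finset.sum_mul]
        exact mul_le_mul_of_nonneg_right (sum_energyScale_sq_le ha hN)
          (mul_nonneg (by norm_num) fourthMoment_nonneg)

lemma modeWeight_projectedVec (N a : ℕ) (ω : Sample N) (k : Fin 3 → ℤ) :
    sqLength k * ∑ j, ‖projectedVec N a ω k j‖ ^ 2 = energyScale a k * projSq N k ω := by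
  simp only [projectedVec, projSq, energyScale, Pi.smul_apply, smul_eq_mul, norm_mul, norm_inv,
    Complex.norm_real, mul_pow, ← Finset.mul_sum, Real.norm_eq_abs, inv_pow, sq_abs]
  ring

lemma modeWeight_rawField (N a : ℕ) (ω : Sample N) (k : Fin 3 → ℤ) :
    modeWeight (rawField N a ω) k
      = energyScale a k * projSq N (if k ∈ halfLattice N then k else -k) ω := by
  unfold modeWeight rawField
  split_ifs
  · exact modeWeight_projectedVec N a ω k
  · have h := modeWeight_projectedVec N a ω (-k)
    rw [sqLength_neg] at h
    have h2 : energyScale a (-k) = energyScale a k := by rw [energyScale, sqLength_neg, energyScale]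
    rw [h2] at h
    simpa using h

lemma energy_eq (N : ℕ) (v : (Fin 3 → ℤ) → Fin 3 → ℂ) :
    energy N v = (1 / 2) * ∑ k ∈ lattice N, modeWeight v k := rfl

lemma energy_nonneg (N : ℕ) (v : (Fin 3 → ℤ) → Fin 3 → ℂ) : 0 ≤ energy N v := by
  rw [energy_eq]
  exact mul_nonneg (by norm_num) (Finset.sum_nonneg fun k _ => modeWeight_nonneg v k)

lemma halfEnergy_le (N a : ℕ) (ω : Sample N) :
    halfEnergy N a ω ≤ 2 * energy N (rawField N a ω) := by
  rw [energy_eq]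
  have h : halfEnergy N a ω = ∑ k ∈ halfLattice N, modeWeight (rawField N a ω) k :=
    Finset.sum_congr rfl fun k hk => by rw [modeWeight_rawField, if_pos hk]
  have h2 : ∑ k ∈ halfLattice N, modeWeight (rawField N a ω) k
      ≤ ∑ k ∈ lattice N, modeWeight (rawField N a ω) k :=
    Finset.sum_le_sum_of_subset_of_nonneg (Finset.filter_subset _ _) fun k _ _ =>
      modeWeight_nonneg _ k
  rw [h]
  linarith

lemma modeWeight_ensembleField (N a : ℕ) (ω : Sample N) (k : Fin 3 → ℤ) :
    modeWeight (ensembleField N a ω) k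
      = modeWeight (rawField N a ω) k / energy N (rawField N a ω) := by
  simp only [modeWeight, ensembleField, Pi.smul_apply, smul_eq_mul, norm_mul, norm_inv,
    Complex.norm_real, mul_pow, ← Finset.mul_sum, Real.norm_eq_abs, inv_pow, sq_abs]
  rw [Real.sq_sqrt (energy_nonneg N _)]
  ring

/-! ### The expected stretching -/

/-- The sum `∑ |k|⁴ |v_k|⁴` of the squared mode weights of the unnormalized field. -/
def sqWeightSum (N a : ℕ) (ω : Sample N) : ℝ :=
  ∑ k ∈ lattice N, modeWeight (rawField N a ω) k ^ 2

lemma sqWeightSum_eq (N a : ℕ) : sqWeightSum N a = fun ω => ∑ k ∈ lattice N,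
    energyScale a k ^ 2 * projSq N (if k ∈ halfLattice N then k else -k) ω ^ 2 := by
  funext ω
  exact Finset.sum_congr rfl fun k _ => by rw [modeWeight_rawField, mul_pow]

lemma integrable_sqWeightSum (N a : ℕ) : Integrable (sqWeightSum N a) (gaussianLaw N) := by
  rw [sqWeightSum_eq]
  exact integrable_finsetSum _ fun k _ => (memLp_projSq N _).integrable_sq.const_mul _

lemma integral_sqWeightSum_le {a : ℕ} (ha : a = 0 ∨ a = 1) {N : ℕ} (hN : 1 ≤ N) :
    ∫ ω, sqWeightSum N a ω ∂(gaussianLaw N)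
      ≤ 243 * ((N : ℝ) ^ 3 * ((N : ℝ) ^ (2 - 2 * a)) ^ 2) * (36 * fourthMoment) := by
  rw [sqWeightSum_eq, integral_finsetSum _ fun k _ =>
    (memLp_projSq N _).integrable_sq.const_mul _]
  calc _ ≤ ∑ k ∈ lattice N, energyScale a k ^ 2 * (36 * fourthMoment) := by
        refine Finset.sum_le_sum fun k _ => ?_
        rw [integral_const_mul]
        exact mul_le_mul_of_nonneg_left (integral_projSq_sq_le N _) (sq_nonneg _)
    _ ≤ _ := by
        rw [← Finset.sum_mul]
        exact mul_le_mul_of_nonneg_right (sum_energyScale_sq_le ha hN)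
          (mul_nonneg (by norm_num) fourthMoment_nonneg)

lemma rho_nonneg (N a : ℕ) (ω : Sample N) : 0 ≤ rho N a ω := specRadius_nonneg _

lemma rho_sq_le (N a : ℕ) (ω : Sample N) :
    rho N a ω ^ 2 ≤ 96 * sqWeightSum N a ω / energy N (rawField N a ω) ^ 2 := by
  refine (specRadius_stretchingMatrix_sq_le N _).trans ?_
  set W := energy N (rawField N a ω) with hW
  have hsum : ∑ k ∈ lattice N, modeWeight (rawField N a ω) k = 2 * W := by
    rw [hW, energy_eq]; ring
  simp only [modeWeight_ensembleField, div_pow, ← Finset.sum_div, ← hW]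
  rw [hsum]
  change 48 * (2 * W / W * (sqWeightSum N a ω / W ^ 2)) ≤ _
  rcases eq_or_ne W 0 with h | h
  · simp [h]
  · rw [mul_div_cancel_right₀ _ h]
    exact le_of_eq (by ring)

/-- The deterministic bound: the weights of the normalized field sum to at most `2`. -/
lemma rho_sq_le_const (N a : ℕ) (ω : Sample N) : rho N a ω ^ 2 ≤ 384 := by
  refine (rho_sq_le N a ω).trans ?_
  set W := energy N (rawField N a ω) with hW
  have hsum : ∑ k ∈ lattice N, modeWeight (rawField N a ω) k = 2 * W := by
    rw [hW, energy_eq]; ring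
  have h : sqWeightSum N a ω ≤ (2 * W) ^ 2 := by
    rw [← hsum]
    exact Finset.sum_sq_le_sq_sum_of_nonneg fun k _ => modeWeight_nonneg _ k
  refine div_le_of_le_mul₀ (sq_nonneg _) (by norm_num) ?_
  nlinarith

/-- If `halfEnergy` is at least half of its mean, the normalization is harmless; otherwise the
deterministic bound is paid for by the deviation of `halfEnergy` from its mean. -/
lemma rho_sq_le_add {N a : ℕ} (hm : 0 < meanHalfEnergy N a) (ω : Sample N) :
    rho N a ω ^ 2 ≤ 1536 / meanHalfEnergy N a ^ 2
      * (sqWeightSum N a ω + (halfEnergy N a ω - meanHalfEnergy N a) ^ 2) := by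
  set m := meanHalfEnergy N a
  have hQ : 0 ≤ sqWeightSum N a ω := Finset.sum_nonneg fun _ _ => sq_nonneg _
  rw [div_mul_eq_mul_div, le_div_iff₀ (by positivity)]
  rcases le_total (m / 2) (halfEnergy N a ω) with h | h
  · have hW : m / 4 ≤ energy N (rawField N a ω) := by
      have := halfEnergy_le N a ω; linarith
    have h1 : rho N a ω ^ 2 ≤ 96 * sqWeightSum N a ω / (m / 4) ^ 2 :=
      (rho_sq_le N a ω).trans (by gcongr)
    rw [le_div_iff₀ (by positivity)] at h1
    nlinarith [sq_nonneg (halfEnergy N a ω - m)]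
  · have h1 : (m / 2) ^ 2 ≤ (halfEnergy N a ω - m) ^ 2 := by
      rw [← neg_sq (halfEnergy N a ω - m)]
      exact pow_le_pow_left₀ (by positivity) (by linarith) 2
    have h2 := mul_le_mul_of_nonneg_right (rho_sq_le_const N a ω) (sq_nonneg m)
    nlinarith

lemma integrable_rho (N a : ℕ) : Integrable (rho N a) (gaussianLaw N) := by
  refine Integrable.of_bound (measurable_rho N a).aestronglyMeasurable 20 (.of_forall fun ω => ?_)
  rw [Real.norm_of_nonneg (rho_nonneg N a ω)]
  nlinarith [rho_sq_le_const N a ω, rho_nonneg N a ω]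

/-- The constant in the second moment bound for `rho`. -/
def rhoConst : ℝ := 1536 * 64 * (2 * (243 * (36 * fourthMoment)))

lemma rhoConst_nonneg : 0 ≤ rhoConst := by
  have := fourthMoment_nonneg
  unfold rhoConst; positivity

lemma integrable_rho_sq (N a : ℕ) : Integrable (fun ω => rho N a ω ^ 2) (gaussianLaw N) := by
  refine Integrable.of_bound ((measurable_rho N a).pow_const 2).aestronglyMeasurable 384
    (.of_forall fun ω => ?_)
  rw [Real.norm_of_nonneg (sq_nonneg _)]
  exact rho_sq_le_const N a ω

lemma integral_rho_sq_le {a : ℕ} (ha : a = 0 ∨ a = 1) {N : ℕ} (hN : 1 ≤ N) :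
    ∫ ω, rho N a ω ^ 2 ∂(gaussianLaw N) ≤ rhoConst / (N : ℝ) ^ 3 := by
  have hN0 : (0 : ℝ) < N := by exact_mod_cast hN
  have hF := fourthMoment_nonneg
  set D : ℝ := (N : ℝ) ^ (2 - 2 * a) with hD
  have hD0 : 0 < D := by positivity
  have hm := le_meanHalfEnergy ha hN
  rw [← hD] at hm
  have hm0 : 0 < meanHalfEnergy N a := lt_of_lt_of_le (by positivity) hm
  have hI1 := integrable_sqWeightSum N a
  have hI2 : Integrable (fun ω => (halfEnergy N a ω - meanHalfEnergy N a) ^ 2) (gaussianLaw N) :=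
    ((memLp_halfEnergy N a).sub (memLp_const _)).integrable_sq
  have h1 := integral_sqWeightSum_le ha hN
  have h2 := integral_halfEnergy_sub_sq_le ha hN
  rw [← hD] at h1 h2
  calc ∫ ω, rho N a ω ^ 2 ∂(gaussianLaw N)
      ≤ ∫ ω, 1536 / meanHalfEnergy N a ^ 2
        * (sqWeightSum N a ω + (halfEnergy N a ω - meanHalfEnergy N a) ^ 2) ∂(gaussianLaw N) :=
        integral_mono (integrable_rho_sq N a) ((hI1.add hI2).const_mul _)
          fun ω => rho_sq_le_add hm0 ω
    _ = 1536 / meanHalfEnergy N a ^ 2 * (∫ ω, sqWeightSum N a ω ∂(gaussianLaw N)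
        + ∫ ω, (halfEnergy N a ω - meanHalfEnergy N a) ^ 2 ∂(gaussianLaw N)) := by
        rw [integral_const_mul, integral_add hI1 hI2]
    _ ≤ 1536 / ((N : ℝ) ^ 3 * D / 8) ^ 2
        * (2 * (243 * ((N : ℝ) ^ 3 * D ^ 2) * (36 * fourthMoment))) := by
        rw [two_mul]
        have hQ : 0 ≤ ∫ ω, sqWeightSum N a ω ∂(gaussianLaw N) :=
          integral_nonneg fun ω => Finset.sum_nonneg fun _ _ => sq_nonneg _
        have hZ : 0 ≤ ∫ ω, (halfEnergy N a ω - meanHalfEnergy N a) ^ 2 ∂(gaussianLaw N) :=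
          integral_nonneg fun ω => sq_nonneg _
        gcongr
    _ = rhoConst / (N : ℝ) ^ 3 := by
        rw [rhoConst]
        field_simp
        ring

lemma integral_rho_le {a : ℕ} (ha : a = 0 ∨ a = 1) {N : ℕ} (hN : 1 ≤ N) :
    ∫ ω, rho N a ω ∂(gaussianLaw N) ≤ (rhoConst + 1) * (N : ℝ) ^ (-(3 / 2) : ℝ) := by
  have hN0 : (0 : ℝ) < N := by exact_mod_cast hN
  set t : ℝ := (N : ℝ) ^ (-(3 / 2) : ℝ) with ht
  have ht0 : 0 < t := Real.rpow_pos_of_pos hN0 _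
  have ht2 : t ^ 2 = ((N : ℝ) ^ 3)⁻¹ := by
    rw [ht, ← Real.rpow_natCast, ← Real.rpow_mul hN0.le, ← Real.rpow_natCast (N : ℝ) 3,
      ← Real.rpow_neg hN0.le]
    norm_num
  -- `t` is the expected size of `rho`, so that both terms on the right are of order `t`.
  have hpt : ∀ ω, rho N a ω ≤ t⁻¹ * rho N a ω ^ 2 + t := fun ω => by
    have h : t * rho N a ω ≤ rho N a ω ^ 2 + t ^ 2 := by
      nlinarith [sq_nonneg (rho N a ω - t), rho_nonneg N a ω]
    rw [← mul_le_mul_iff_right₀ ht0]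
    calc t * rho N a ω ≤ rho N a ω ^ 2 + t ^ 2 := h
      _ = _ := by field_simp
  calc ∫ ω, rho N a ω ∂(gaussianLaw N)
      ≤ ∫ ω, (t⁻¹ * rho N a ω ^ 2 + t) ∂(gaussianLaw N) :=
        integral_mono (integrable_rho N a)
          (((integrable_rho_sq N a).const_mul _).add (integrable_const _)) hpt
    _ = t⁻¹ * (∫ ω, rho N a ω ^ 2 ∂(gaussianLaw N)) + t := by
        rw [integral_add ((integrable_rho_sq N a).const_mul _) (integrable_const _),
          integral_const_mul]
        simp
    _ ≤ t⁻¹ * (rhoConst / (N : ℝ) ^ 3) + t := by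
        gcongr; exact integral_rho_sq_le ha hN
    _ = (rhoConst + 1) * t := by
        rw [div_eq_mul_inv, ← ht2]
        field_simp

end OrbitStretching

end

theorem mainTheorem3 :
    ∀ ε : ℝ, 0 < ε → ∃ C : ℝ, 0 < C ∧
      ∀ a : ℕ, (a = 0 ∨ a = 1) → ∀ N : ℕ, 1 ≤ N →
        (Integrable (OrbitStretching.rho N a) (OrbitStretching.gaussianLaw N) ∧
          ∫ ω, OrbitStretching.rho N a ω ∂(OrbitStretching.gaussianLaw N)
            ≤ C * (N : ℝ) ^ (-(3 / 2) + ε : ℝ)) ∧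
        (Integrable (OrbitStretching.nuCrit N a) (OrbitStretching.gaussianLaw N) ∧
          ∫ ω, OrbitStretching.nuCrit N a ω ∂(OrbitStretching.gaussianLaw N)
            ≤ C * (N : ℝ) ^ (-(7 / 2) + ε : ℝ)) := by
  intro ε hε
  have hC := OrbitStretching.rhoConst_nonneg
  refine ⟨OrbitStretching.rhoConst + 1, by linarith, fun a ha N hN => ?_⟩
  have hN1 : (1 : ℝ) ≤ N := by exact_mod_cast hN
  have hN0 : (0 : ℝ) < N := by linarith
  have hI := OrbitStretching.integrable_rho N a
  have hle : ∫ ω, OrbitStretching.rho N a ω ∂(OrbitStretching.gaussianLaw N)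
      ≤ (OrbitStretching.rhoConst + 1) * (N : ℝ) ^ (-(3 / 2) + ε : ℝ) :=
    (OrbitStretching.integral_rho_le ha hN).trans (mul_le_mul_of_nonneg_left
      (Real.rpow_le_rpow_of_exponent_le hN1 (by linarith)) (by linarith))
  refine ⟨⟨hI, hle⟩, hI.div_const _, ?_⟩
  have hexp : (N : ℝ) ^ (-(7 / 2) + ε : ℝ) = (N : ℝ) ^ (-(3 / 2) + ε : ℝ) / (N : ℝ) ^ 2 := by
    rw [← Real.rpow_natCast (N : ℝ) 2, ← Real.rpow_sub hN0]
    congr 1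
    norm_num
    ring
  unfold OrbitStretching.nuCrit
  rw [integral_div, hexp, ← mul_div_assoc]
  exact div_le_div_of_nonneg_right hle (by positivity)
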